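/- A parity game $G=(V,E,\mathcal P,(V_0,V_1))$ consists of a finite set $V$ partitioned into the vertices $V_0$ of player even and $V_1$ of player odd, a total edge relation $E\subseteq V\times V$, and priorities $\mathcal P:V\to\mathbb N$. An infinite play is won by even iff the highest priority occurring infinitely often is even; a vertex is won by player $i$ if $i$ has a strategy winning every consistent play from it. $G$ is *weak* if $\mathcal P(w)\le\mathcal P(v)$ for every edge $(v,w)$, and a *paradise* for $i$ if all its vertices are won by $i$ (the empty game counts as a paradise). $\mathrm{Attr}_i(U)=\bigcup_n \mathrm{Attr}^n_i(U)$, where $\mathrm{Attr}^0_i(U)=U$ and $\mathrm{Attr}^{n+1}_i(U)$ adds to $\mathrm{Attr}^n_i(U)$ all vertices of $i$ with some successor in it and all vertices of the opponent with all successors in it. $G\setminus A$ is the subgame induced by $V\setminus A$. *Zielonka's algorithm* returns $(\emptyset,\emptyset)$ on the empty game. Otherwise let $m$ be the highest priority, $p$ the player with the parity of $m$, $\bar p$ the opponent, $U=\{v:\mathcal P(v)=m\}$ and $A=\mathrm{Attr}_p(U)$. The first recursive call on $G\setminus A$ returns $(W'_p,W'_{\bar p})$. If $W'_{\bar p}=\emptyset$,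 return $W_p=A\cup W'_p$ and $W_{\bar p}=\emptyset$. Otherwise let $B=\mathrm{Attr}_{\bar p}(W'_{\bar p})$; the second recursive call on $G\setminus B$ returns $(W''_p,W''_{\bar p})$; return $W_p=W''_p$ and $W_{\bar p}=W''_{\bar p}\cup B$. Running time is counted in inspections of vertices and edges, where vertices can be inspected in order of priority. For $N\subseteq V$ let $\mathrm{work}(N)$ be $|N|$ plus the number of edges of the current game with an endpoint in $N$. A call on the empty game costs $1$. A call on a non-empty game costs $1+|U|+\mathrm{work}(N_A)$, where $N_A$ is $A$ together with all predecessors of vertices of $A$, plus, if the second call is reached, $\mathrm{work}(V\setminus W'_{\bar p})$ for computing $B$ and forming $G\setminus B$, plus the cost of its recursive calls. **Theorem.** There is a constant $C$ such that for every weak parity game $G=(V,E,\mathcal P,(V_0,V_1))$ with $d$ different priorities: 1. Zielonka's algorithm solves $G$: for each player $i$ it returns exactly the set of vertices won by $i$. 2. Whenever, during the run on $G$, a call of the algorithm on a game $H$ reaches its second recursive call, the argument $H'=(V',E',\dots)$ of that second call is a weak parity game, it is a paradise (possibly empty) for the player whose parity is that of the highest priority of $H$, and the algorithm takes at most $C\,(|V'|+|E'|+1)$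 steps on $H'$. 3. The algorithm takes at most $C\,\bigl(d\,(|V|+|E|)+1\bigr)$ steps on $G$, i.e. it runs in time $\mathcal O(d\cdot(|V|+|E|))$. -/

import Mathlib

/-- The two players: `even` (diamond) and `odd` (square). -/
inductive Player where
  | even : Player
  | odd : Player
  deriving DecidableEq

/-- The opponent of a player. -/
def Player.opp : Player → Player
  | .even => .odd
  | .odd => .even

/-- The player favoured by a priority: `even` for even priorities, `odd` for odd ones. -/
def Player.ofPrio (m : ℕ) : Player := if m % 2 = 0 then .even else .odd

/-- A pseudo parity game `(V, E, P, (V_even, V_odd))` with vertices from an ambient type `α`: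
`V` is a finite set, `E ⊆ V × V`, and each vertex has an owner and a priority. The values of
`owner` and `prio` outside `V` play no role. -/
structure PseudoParityGame (α : Type*) where
  verts : Finset α
  edges : Finset (α × α)
  edges_subset : ∀ e ∈ edges, e.1 ∈ verts ∧ e.2 ∈ verts
  owner : α → Player
  prio : α → ℕ

namespace PseudoParityGame

variable {α : Type*}

/-- A parity game is a pseudo parity game whose edge relation is total. -/
def IsParityGame (G : PseudoParityGame α) : Prop :=
  ∀ v ∈ G.verts, ∃ w, (v, w) ∈ G.edges

/-- Weak games: priorities never increase along edges. -/
def IsWeak (G : PseudoParityGame α) : Prop :=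
  ∀ v w, (v, w) ∈ G.edges → G.prio w ≤ G.prio v

/-- The number `d` of different priorities that occur in `G`. -/
def numPrios (G : PseudoParityGame α) : ℕ := (G.verts.image G.prio).card

/-- The subgame `G \ A`, on the vertices outside `A`, with all edges of `G` between them. -/
def remove [DecidableEq α] (G : PseudoParityGame α) (A : Finset α) : PseudoParityGame α where
  verts := G.verts \ A
  edges := G.edges.filter fun e => e.1 ∉ A ∧ e.2 ∉ A
  edges_subset := by
    intro e he
    rw [Finset.mem_filter] at he
    have h := G.edges_subset e he.1
    exact ⟨Finset.mem_sdiff.2 ⟨h.1, he.2.1⟩, Finset.mem_sdiff.2 ⟨h.2, he.2.2⟩⟩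
  owner := G.owner
  prio := G.prio

/-! ### Plays, strategies, winning -/

/-- A (history-dependent, partial) strategy of player `i`: whenever it is defined on a finite
sequence `v₁, …, vₙ`, the vertex `vₙ` belongs to `i` and the value is a successor of `vₙ`. -/
structure Strategy (G : PseudoParityGame α) (i : Player) where
  move : List α → Option α
  valid : ∀ h w, move h = some w → ∃ v, h.getLast? = some v ∧ G.owner v = i ∧ (v, w) ∈ G.edges

/-- Infinite paths of `G`. -/
def IsPlay (G : PseudoParityGame α) (ρ : ℕ → α) : Prop :=
  ∀ n, (ρ n, ρ (n + 1)) ∈ G.edges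

/-- The infinite path `ρ` follows the strategy `σ` on every finite prefix where `σ` is defined. -/
def Strategy.Consistent {G : PseudoParityGame α} {i : Player} (σ : G.Strategy i) (ρ : ℕ → α) :
    Prop :=
  ∀ n w, σ.move ((List.range (n + 1)).map ρ) = some w → ρ (n + 1) = w

/-- Player `i` wins the play `ρ`: the highest priority occurring infinitely often on `ρ` has the
parity of `i`. -/
def WinsPlay (G : PseudoParityGame α) (i : Player) (ρ : ℕ → α) : Prop :=
  ∃ m, (∃ᶠ n in Filter.atTop, G.prio (ρ n) = m) ∧
    (∀ k, (∃ᶠ n in Filter.atTop, G.prio (ρ n) = k) → k ≤ m) ∧ Player.ofPrio m = i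

/-- The vertex `v` is won by `i`: player `i` has a strategy that wins every play starting in `v`
and consistent with it. -/
def WonBy (G : PseudoParityGame α) (i : Player) (v : α) : Prop :=
  ∃ σ : G.Strategy i, ∀ ρ, G.IsPlay ρ → ρ 0 = v → σ.Consistent ρ → G.WinsPlay i ρ

/-- `G` is a paradise for `i`: all vertices are won by `i`. -/
def IsParadise (G : PseudoParityGame α) (i : Player) : Prop :=
  ∀ v ∈ G.verts, G.WonBy i v

/-! ### Attractors -/

/-- The `n`-th stage of the `i`-attractor into `U`. -/
def attrStage [DecidableEq α] (G : PseudoParityGame α) (i : Player) (U : Finset α) :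
    ℕ → Finset α
  | 0 => U
  | n + 1 =>
    attrStage G i U n
      ∪ G.verts.filter (fun u => G.owner u = i ∧ ∃ v ∈ attrStage G i U n, (u, v) ∈ G.edges)
      ∪ G.verts.filter (fun u => G.owner u = i.opp ∧
          ∀ v ∈ G.verts, (u, v) ∈ G.edges → v ∈ attrStage G i U n)

open Classical in
/-- The `i`-attractor into `U ⊆ V`, the union of all stages. -/
noncomputable def attr (G : PseudoParityGame α) (i : Player) (U : Finset α) : Finset α :=
  G.verts.filter fun v => ∃ n, v ∈ G.attrStage i U n

theorem subset_attr (G : PseudoParityGame α) (i : Player) {U : Finset α} (hU : U ⊆ G.verts) :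
    U ⊆ G.attr i U := by
  classical
  intro v hv
  exact Finset.mem_filter.2 ⟨hU hv, 0, hv⟩

theorem attr_subset (G : PseudoParityGame α) (i : Player) (U : Finset α) :
    G.attr i U ⊆ G.verts := by
  classical
  exact Finset.filter_subset _ _

/-! ### Zielonka's algorithm -/

/-- The highest priority `m` of a (non-empty) game. -/
def maxPrio (G : PseudoParityGame α) : ℕ := G.verts.sup G.prio

/-- The player `p` whose parity is that of the highest priority. -/
def topPlayer (G : PseudoParityGame α) : Player := Player.ofPrio G.maxPrio

/-- The set `U` of vertices with the highest priority. -/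
def topSet (G : PseudoParityGame α) : Finset α := G.verts.filter fun v => G.prio v = G.maxPrio

/-- The set `A`, the `p`-attractor into `U`. -/
noncomputable def topAttr (G : PseudoParityGame α) : Finset α := G.attr G.topPlayer G.topSet

theorem card_remove_lt [DecidableEq α] (G : PseudoParityGame α) {X A : Finset α}
    (hne : X.Nonempty) (hX : X ⊆ G.verts) (hA : X ⊆ A) :
    (G.remove A).verts.card < G.verts.card := by
  obtain ⟨v, hv⟩ := hne
  refine Finset.card_lt_card ⟨Finset.sdiff_subset, fun h => ?_⟩
  exact (Finset.mem_sdiff.1 (h (hX hv))).2 (hA hv)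

theorem topSet_nonempty (G : PseudoParityGame α) (h : G.verts ≠ ∅) : G.topSet.Nonempty := by
  obtain ⟨v, hv, hmax⟩ :=
    Finset.exists_mem_eq_sup G.verts (Finset.nonempty_iff_ne_empty.2 h) G.prio
  exact ⟨v, Finset.mem_filter.2 ⟨hv, hmax.symm⟩⟩

/-- The vertices of `N` together with the edges of `G` that have an endpoint in `N`: the number of
elementary steps for handling each of them once. -/
def work [DecidableEq α] (G : PseudoParityGame α) (N : Finset α) : ℕ :=
  N.card + (G.edges.filter fun e => e.1 ∈ N ∨ e.2 ∈ N).card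

/-- `A` together with the predecessors of vertices of `A`: the vertices that are touched when the
attractor `A` is computed by a backward search and then cut out of the game. -/
def touched [DecidableEq α] (G : PseudoParityGame α) (A : Finset α) : Finset α :=
  A ∪ G.verts.filter fun u => ∃ v ∈ A, (u, v) ∈ G.edges

/-- The outcome of a run on a game with vertex set `S`: the computed winning sets
`win .even`, `win .odd` and the number of steps spent, recursive calls included. -/
structure Outcome (S : Finset α) where
  win : Player → Finset α
  win_subset : ∀ i, win i ⊆ S
  steps : ℕ

/-- Zielonka's recursive algorithm with its step count. Vertices can be inspected in the order of
their priority. A call with non-empty game is charged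
* one step for the bookkeeping of constant cost (emptiness tests, `m` and `p`);
* `|U|` steps for collecting `U`;
* for computing `A` by a backward search from `U`, cutting it out to form `G \ A`, and adding it
  to a result: one step for each vertex of `A`, each predecessor of `A`, and each edge of the
  current game incident with one of these;
* if the second call is reached, for computing `B` by scanning the vertices not yet known to be
  attracted, forming `G \ B`, and updating the results: one step for each vertex of
  `V \ W'` and each edge of the current game incident with one of these, where `W'` is the set
  won by the opponent of `p` in the first call;
* the steps of the recursive calls.

A call with the empty game is charged one step. -/
noncomputable def zielonka [DecidableEq α] (G : PseudoParityGame α) : Outcome G.verts :=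
  if hV : G.verts = ∅ then
    { win := fun _ => ∅
      win_subset := fun _ => Finset.empty_subset _
      steps := 1 }
  else
    let p := G.topPlayer
    let A := G.topAttr
    let r := zielonka (G.remove A)
    if hW : r.win p.opp = ∅ then
      { win := fun i => if i = p then A ∪ r.win p else ∅
        win_subset := by
          intro i
          split_ifs
          · exact Finset.union_subset (G.attr_subset _ _)
              ((r.win_subset p).trans Finset.sdiff_subset)
          · exact Finset.empty_subset _
        steps := 1 + G.topSet.card + G.work (G.touched A) + r.steps }
    else
      let B := G.attr p.opp (r.win p.opp)
      let s := zielonka (G.remove B)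
      { win := fun i => if i = p then s.win p else s.win p.opp ∪ B
        win_subset := by
          intro i
          split_ifs
          · exact (s.win_subset p).trans Finset.sdiff_subset
          · exact Finset.union_subset ((s.win_subset _).trans Finset.sdiff_subset)
              (G.attr_subset _ _)
        steps := 1 + G.topSet.card + G.work (G.touched A) + r.steps
          + G.work (G.verts \ r.win p.opp) + s.steps }
termination_by G.verts.card
decreasing_by
  · exact G.card_remove_lt (G.topSet_nonempty hV) (Finset.filter_subset _ _)
      (G.subset_attr _ (Finset.filter_subset _ _))
  · have hsub : r.win p.opp ⊆ G.verts := (r.win_subset _).trans Finset.sdiff_subset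
    exact G.card_remove_lt (Finset.nonempty_iff_ne_empty.2 hW) hsub (G.subset_attr _ hsub)

/-- The argument `G \ A` of the first recursive call of Zielonka's algorithm on `G`. -/
noncomputable def firstArg [DecidableEq α] (G : PseudoParityGame α) : PseudoParityGame α :=
  G.remove G.topAttr

/-- The set `W'` of vertices which the first recursive call assigns to the opponent of `p`. -/
noncomputable def oppWin [DecidableEq α] (G : PseudoParityGame α) : Finset α :=
  (zielonka G.firstArg).win G.topPlayer.opp

/-- The algorithm, called on `G`, reaches its second recursive call. -/
def ReachesSecondCall [DecidableEq α] (G : PseudoParityGame α) : Prop :=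
  G.verts ≠ ∅ ∧ G.oppWin ≠ ∅

/-- The argument `G \ B` of the second recursive call of Zielonka's algorithm on `G`. -/
noncomputable def secondArg [DecidableEq α] (G : PseudoParityGame α) : PseudoParityGame α :=
  G.remove (G.attr G.topPlayer.opp G.oppWin)

/-- `G.Invokes H`: during the run of Zielonka's algorithm on `G`, the algorithm is called on `H`
(the call on `G` itself included). -/
inductive Invokes [DecidableEq α] (G : PseudoParityGame α) : PseudoParityGame α → Prop
  | self : Invokes G G
  | first (H : PseudoParityGame α) : Invokes G H → H.verts ≠ ∅ → Invokes G H.firstArg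
  | second (H : PseudoParityGame α) : Invokes G H → H.ReachesSecondCall → Invokes G H.secondArg

end PseudoParityGame

/-! In a weak game no edge leads from a vertex of lower priority into the top layer `U`
(`IsWeak.mem_topSet_of_edge`). By totality the attractor of `U` is then `U` itself, and winning
regions of the first argument remain winning regions of the whole game
(`IsWinningRegion.of_firstArg`). The opponent therefore wins all of `B`. The rest consists of
vertices of `U` and of vertices that `p` wins below, and `p` can stay in it: a play there either
remains in `U`, seeing only the priority `m`, or enters the part won below. So the second call
receives a paradise for `p` (`exists_isWinningRegion_secondArg`). Correctness follows by induction
on the number of vertices, with positional winning regions carrying the argument.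

For the running time, consider first a game won entirely by one player `q`
(`steps_le_of_win_opp_eq_empty`). Its first argument is won by `q` too. A second call can then only
occur if `q` is the opponent of `p`; its argument is empty, and only `U` remains to be scanned for
`B`. The cost of one level is proportional to the vertices and edges deleted with `U`, so the sum
telescopes to a linear bound. In a general weak game each first call removes one priority, and
everything else on a level, second call included, is linear (`steps_le`). -/

namespace Player

theorem opp_opp (i : Player) : i.opp.opp = i := by cases i <;> rfl

theorem opp_ne (i : Player) : i.opp ≠ i := by cases i <;> simp [opp]

theorem eq_or_eq_opp (i j : Player) : i = j ∨ i = j.opp := by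
  cases i <;> cases j <;> simp [opp]

end Player

namespace PseudoParityGame

variable {α : Type*}

/-! ### Plays -/

theorem frequently_atTop_shift (P : ℕ → Prop) (n : ℕ) :
    (∃ᶠ k in Filter.atTop, P (k + n)) ↔ ∃ᶠ k in Filter.atTop, P k := by
  conv_rhs => rw [← Filter.map_add_atTop_eq_nat n]
  exact Filter.frequently_map.symm

theorem WinsPlay.of_tail {G : PseudoParityGame α} {i : Player} {ρ : ℕ → α} (n : ℕ)
    (h : G.WinsPlay i fun k => ρ (k + n)) : G.WinsPlay i ρ := by
  obtain ⟨m, h1, h2, h3⟩ := h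
  refine ⟨m, (frequently_atTop_shift (fun k => G.prio (ρ k) = m) n).1 h1, fun k hk => ?_, h3⟩
  exact h2 k ((frequently_atTop_shift (fun j => G.prio (ρ j) = k) n).2 hk)

theorem WinsPlay.not_opp {G : PseudoParityGame α} {i : Player} {ρ : ℕ → α}
    (h : G.WinsPlay i ρ) : ¬ G.WinsPlay i.opp ρ := by
  rintro ⟨m', h1', h2', h3'⟩
  obtain ⟨m, h1, h2, h3⟩ := h
  have : m = m' := le_antisymm (h2' _ h1) (h2 _ h1')
  subst this
  exact i.opp_ne (h3'.symm.trans h3)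

theorem winsPlay_of_const {G : PseudoParityGame α} {ρ : ℕ → α} {m : ℕ}
    (h : ∀ n, G.prio (ρ n) = m) : G.WinsPlay (Player.ofPrio m) ρ := by
  refine ⟨m, (Filter.Eventually.of_forall h).frequently, fun k hk => ?_, rfl⟩
  obtain ⟨n, hn⟩ := hk.exists
  exact (hn.symm.trans (h n)).le

/-! ### Positional winning regions -/

/-- The set `W` is closed under the moves of the opponent of `i` and under the positional strategy
`f` of `i`, and every play in `W` that follows `f` is won by `i`. -/
structure IsWinningRegion (G : PseudoParityGame α) (i : Player) (W : Finset α) (f : α → α) :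
    Prop where
  subset : W ⊆ G.verts
  move : ∀ v ∈ W, G.owner v = i → (v, f v) ∈ G.edges ∧ f v ∈ W
  closed : ∀ v ∈ W, G.owner v = i.opp → ∀ w, (v, w) ∈ G.edges → w ∈ W
  wins : ∀ ρ, G.IsPlay ρ → (∀ n, ρ n ∈ W) → (∀ n, G.owner (ρ n) = i → ρ (n + 1) = f (ρ n)) →
    G.WinsPlay i ρ

theorem isWinningRegion_empty (G : PseudoParityGame α) (i : Player) :
    G.IsWinningRegion i ∅ id :=
  ⟨by simp, by simp, by simp, fun _ _ h => absurd (h 0) (by simp)⟩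

/-- Extending a winning region: outside `R`, the strategy `g` stays in `S` and wins all plays that
never reach `R`. -/
theorem IsWinningRegion.extend [DecidableEq α] {G : PseudoParityGame α} {i : Player}
    {R S : Finset α} {f g : α → α} (hR : G.IsWinningRegion i R f) (hRS : R ⊆ S)
    (hS : S ⊆ G.verts)
    (hmove : ∀ v ∈ S, v ∉ R → G.owner v = i → (v, g v) ∈ G.edges ∧ g v ∈ S)
    (hclosed : ∀ v ∈ S, v ∉ R → G.owner v = i.opp → ∀ w, (v, w) ∈ G.edges → w ∈ S)
    (hwins : ∀ ρ, G.IsPlay ρ → (∀ n, ρ n ∈ S) → (∀ n, ρ n ∉ R) →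
      (∀ n, G.owner (ρ n) = i → ρ (n + 1) = g (ρ n)) → G.WinsPlay i ρ) :
    G.IsWinningRegion i S fun v => if v ∈ R then f v else g v := by
  refine ⟨hS, fun v hv ho => ?_, fun v hv ho w hw => ?_, fun ρ hρ hmem hfol => ?_⟩
  · by_cases h : v ∈ R
    · simpa [h] using ⟨(hR.move v h ho).1, hRS (hR.move v h ho).2⟩
    · simpa [h] using hmove v hv h ho
  · by_cases h : v ∈ R
    · exact hRS (hR.closed v h ho w hw)
    · exact hclosed v hv h ho w hw
  -- A play that enters `R` is trapped there, and winning depends only on its tail; a play that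
  -- never enters is covered by `hwins`.
  · by_cases hit : ∃ n, ρ n ∈ R
    · obtain ⟨n, hn⟩ := hit
      have hstay : ∀ k, ρ (k + n) ∈ R := by
        intro k
        induction k with
        | zero => simpa using hn
        | succ k ih =>
          have he := hρ (k + n)
          rw [Nat.add_right_comm]
          rcases (G.owner (ρ (k + n))).eq_or_eq_opp i with ho | ho
          · have := hfol _ ho
            rw [if_pos ih] at this
            rw [this]
            exact (hR.move _ ih ho).2
          · exact hR.closed _ ih ho _ he
      refine WinsPlay.of_tail n (hR.wins _ (fun k => ?_) hstay fun k ho => ?_)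
      · have := hρ (k + n)
        rwa [Nat.add_right_comm] at this
      · have := hfol _ ho
        rw [if_pos (hstay k), Nat.add_right_comm] at this
        exact this
    · push Not at hit
      refine hwins ρ hρ hmem hit fun n ho => ?_
      rw [hfol n ho, if_neg (hit n)]

/-- Restoring `X` gives new moves to both players, but `i` may ignore the new ones; only opponent
edges into `X` could do harm. -/
theorem IsWinningRegion.of_remove [DecidableEq α] {G : PseudoParityGame α} {X W : Finset α}
    {i : Player} {f : α → α} (h : (G.remove X).IsWinningRegion i W f)
    (htrap : ∀ v ∈ W, G.owner v = i.opp → ∀ w, (v, w) ∈ G.edges → w ∉ X) :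
    G.IsWinningRegion i W f := by
  have hX : ∀ v ∈ W, v ∉ X := fun v hv => (Finset.mem_sdiff.1 (h.subset hv)).2
  refine ⟨h.subset.trans Finset.sdiff_subset, fun v hv ho => ?_, fun v hv ho w hw => ?_,
    fun ρ hρ hmem hfol => ?_⟩
  · exact ⟨(Finset.mem_filter.1 (h.move v hv ho).1).1, (h.move v hv ho).2⟩
  · exact h.closed v hv ho w (Finset.mem_filter.2 ⟨hw, hX v hv, htrap v hv ho w hw⟩)
  · exact h.wins ρ (fun n => Finset.mem_filter.2 ⟨hρ n, hX _ (hmem n), hX _ (hmem (n + 1))⟩)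
      hmem hfol

theorem IsWinningRegion.remove [DecidableEq α] {G : PseudoParityGame α} {X W : Finset α}
    {i : Player} {f : α → α} (h : G.IsWinningRegion i W f) (hX : ∀ v ∈ W, v ∉ X) :
    (G.remove X).IsWinningRegion i W f := by
  refine ⟨fun v hv => Finset.mem_sdiff.2 ⟨h.subset hv, hX v hv⟩, fun v hv ho => ?_,
    fun v hv ho w hw => ?_, fun ρ hρ hmem hfol => ?_⟩
  · have := h.move v hv ho
    exact ⟨Finset.mem_filter.2 ⟨this.1, hX v hv, hX _ this.2⟩, this.2⟩
  · exact h.closed v hv ho w (Finset.mem_filter.1 hw).1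
  · exact h.wins ρ (fun n => (Finset.mem_filter.1 (hρ n)).1) hmem hfol

theorem getLast?_map_range (ρ : ℕ → α) (n : ℕ) :
    ((List.range (n + 1)).map ρ).getLast? = some (ρ n) := by
  simp [List.range_succ]

theorem IsWinningRegion.wonBy {G : PseudoParityGame α} {i : Player} {W : Finset α} {f : α → α}
    (h : G.IsWinningRegion i W f) {v : α} (hv : v ∈ W) : G.WonBy i v := by
  classical
  let σ : G.Strategy i :=
    { move := fun l => l.getLast?.bind fun u =>
        if u ∈ W ∧ G.owner u = i then some (f u) else none
      valid := by
        intro l w hw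
        rw [Option.bind_eq_some_iff] at hw
        obtain ⟨u, hu, hw⟩ := hw
        split_ifs at hw with hc
        cases hw
        exact ⟨u, hu, hc.2, (h.move u hc.1 hc.2).1⟩ }
  refine ⟨σ, fun ρ hρ h0 hσ => ?_⟩
  have hstep : ∀ n, ρ n ∈ W → G.owner (ρ n) = i → ρ (n + 1) = f (ρ n) := by
    intro n hn ho
    refine hσ n _ ?_
    change (((List.range (n + 1)).map ρ).getLast?.bind _) = _
    rw [getLast?_map_range]
    simp [hn, ho]
  have hmem : ∀ n, ρ n ∈ W := by
    intro n
    induction n with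
    | zero => rwa [h0]
    | succ n ih =>
      rcases (G.owner (ρ n)).eq_or_eq_opp i with ho | ho
      · rw [hstep n ih ho]
        exact (h.move _ ih ho).2
      · exact h.closed _ ih ho _ (hρ n)
  exact h.wins ρ hρ hmem fun n => hstep n (hmem n)

/-- As `next` sees the whole past, the recursion runs on growing histories, and `ρ` reads off the
value appended at each stage. -/
theorem exists_history (next : List α → α) (v : α) :
    ∃ ρ : ℕ → α, ρ 0 = v ∧ ∀ n, ρ (n + 1) = next ((List.range (n + 1)).map ρ) := by
  let hist : ℕ → List α := fun n => Nat.rec [v] (fun _ l => l ++ [next l]) n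
  let ρ : ℕ → α := fun n => Nat.casesOn n v fun k => next (hist k)
  have hh : ∀ n, (List.range (n + 1)).map ρ = hist n := by
    intro n
    induction n with
    | zero => rfl
    | succ n ih =>
      rw [List.range_succ, List.map_append, ih]
      rfl
  exact ⟨ρ, rfl, fun n => by rw [hh]⟩

/-- An arbitrary strategy `σ` is played against the positional `f`; the resulting play would be won
by both players. -/
theorem IsWinningRegion.not_wonBy {G : PseudoParityGame α} (hG : G.IsParityGame) {i : Player}
    {W : Finset α} {f : α → α} (h : G.IsWinningRegion i.opp W f) {v : α} (hv : v ∈ W) :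
    ¬ G.WonBy i v := by
  classical
  rintro ⟨σ, hσ⟩
  have hsucc : ∀ u, ∃ w, u ∈ W → (u, w) ∈ G.edges := fun u => by
    by_cases hu : u ∈ W
    · obtain ⟨w, hw⟩ := hG u (h.subset hu)
      exact ⟨w, fun _ => hw⟩
    · exact ⟨u, fun hu' => absurd hu' hu⟩
  choose s hs using hsucc
  -- Since `σ` is partial, `g` supplies the move wherever `σ` is undefined: an arbitrary successor
  -- for `i`, and `f` for the opponent.
  let g : α → α := fun u => if G.owner u = i then s u else f u
  obtain ⟨ρ, h0, hρ⟩ := exists_history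
    (fun l => (σ.move l).getD (g (l.getLast?.getD v))) v
  simp only [getLast?_map_range, Option.getD_some] at hρ
  have hcase : ∀ n, (∃ w, σ.move ((List.range (n + 1)).map ρ) = some w ∧ ρ (n + 1) = w ∧
      G.owner (ρ n) = i ∧ (ρ n, w) ∈ G.edges) ∨ ρ (n + 1) = g (ρ n) := by
    intro n
    cases hm : σ.move ((List.range (n + 1)).map ρ) with
    | none => right; rw [hρ, hm]; rfl
    | some w =>
      left
      obtain ⟨u, hu, ho, he⟩ := σ.valid _ _ hm
      rw [getLast?_map_range] at hu
      cases hu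
      exact ⟨w, rfl, by rw [hρ, hm]; rfl, ho, he⟩
  have hfol : ∀ n, G.owner (ρ n) = i.opp → ρ (n + 1) = f (ρ n) := by
    intro n ho
    have hne : G.owner (ρ n) ≠ i := by rw [ho]; exact i.opp_ne
    rcases hcase n with ⟨w, -, -, ho', -⟩ | hg
    · exact absurd ho' hne
    · rw [hg]; exact if_neg hne
  have hstep : ∀ n, ρ n ∈ W → (ρ n, ρ (n + 1)) ∈ G.edges ∧ ρ (n + 1) ∈ W := by
    intro n hn
    rcases (G.owner (ρ n)).eq_or_eq_opp i with ho | ho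
    · have he : (ρ n, ρ (n + 1)) ∈ G.edges := by
        rcases hcase n with ⟨w, -, hw, -, he⟩ | hg
        · rwa [hw]
        · rw [hg]
          change (ρ n, if G.owner (ρ n) = i then _ else _) ∈ _
          rw [if_pos ho]
          exact hs _ hn
      exact ⟨he, h.closed _ hn (by rw [ho, Player.opp_opp]) _ he⟩
    · rw [hfol n ho]
      exact h.move _ hn ho
  have hmem : ∀ n, ρ n ∈ W := by
    intro n
    induction n with
    | zero => rwa [h0]
    | succ n ih => exact (hstep n ih).2
  have hplay : G.IsPlay ρ := fun n => (hstep n (hmem n)).1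
  refine (hσ ρ hplay h0 fun n w hw => ?_).not_opp (h.wins ρ hplay hmem hfol)
  rw [hρ, hw]; rfl

theorem IsWinningRegion.notMem_of_opp {G : PseudoParityGame α} (hG : G.IsParityGame) {i : Player}
    {W W' : Finset α} {f f' : α → α} (h : G.IsWinningRegion i W f)
    (h' : G.IsWinningRegion i.opp W' f') {v : α} (hv : v ∈ W) : v ∉ W' :=
  fun hv' => h'.not_wonBy hG hv' (h.wonBy hv)

/-! ### Attractors -/

theorem attrStage_mono [DecidableEq α] (G : PseudoParityGame α) (i : Player) (U : Finset α) :
    Monotone (G.attrStage i U) :=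
  monotone_nat_of_le_succ fun _ _ h =>
    Finset.mem_union_left _ (Finset.mem_union_left _ h)

theorem attrStage_subset [DecidableEq α] {G : PseudoParityGame α} {i : Player} {U : Finset α}
    (hU : U ⊆ G.verts) : ∀ n, G.attrStage i U n ⊆ G.verts
  | 0 => hU
  | n + 1 => Finset.union_subset (Finset.union_subset (attrStage_subset hU n)
      (Finset.filter_subset _ _)) (Finset.filter_subset _ _)

theorem mem_attrStage_succ [DecidableEq α] {G : PseudoParityGame α} {i : Player} {U : Finset α}
    {n : ℕ} {u : α} : u ∈ G.attrStage i U (n + 1) ↔ u ∈ G.attrStage i U n ∨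
      (u ∈ G.verts ∧ G.owner u = i ∧ ∃ v ∈ G.attrStage i U n, (u, v) ∈ G.edges) ∨
      (u ∈ G.verts ∧ G.owner u = i.opp ∧
        ∀ v, (u, v) ∈ G.edges → v ∈ G.attrStage i U n) := by
  simp only [attrStage, Finset.mem_union, Finset.mem_filter, or_assoc]
  refine or_congr_right (or_congr_right (and_congr_right fun _ => and_congr_right fun _ => ?_))
  exact ⟨fun h v he => h v (G.edges_subset _ he).2 he, fun h v _ he => h v he⟩

theorem mem_attr [DecidableEq α] {G : PseudoParityGame α} {i : Player} {U : Finset α}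
    (hU : U ⊆ G.verts) {v : α} : v ∈ G.attr i U ↔ ∃ n, v ∈ G.attrStage i U n := by
  classical
  unfold attr
  rw [Finset.mem_filter]
  constructor
  · rintro ⟨-, n, hn⟩
    -- `attr` is defined with classical decidable equality; `convert` reconciles it with the given
    -- instance.
    exact ⟨n, by convert hn⟩
  · rintro ⟨n, hn⟩
    exact ⟨attrStage_subset hU n hn, n, by convert hn⟩

/-- The attractor is finite and the stages increase, so the largest of the stages chosen for its
members suffices. -/
theorem exists_attr_eq_attrStage [DecidableEq α] {G : PseudoParityGame α} {i : Player}
    {U : Finset α} (hU : U ⊆ G.verts) : ∃ n, G.attr i U = G.attrStage i U n := by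
  have hex : ∀ v, ∃ n, v ∈ G.attr i U → v ∈ G.attrStage i U n := fun v => by
    by_cases hv : v ∈ G.attr i U
    · obtain ⟨n, hn⟩ := (mem_attr hU).1 hv
      exact ⟨n, fun _ => hn⟩
    · exact ⟨0, fun h => absurd h hv⟩
  choose r hr using hex
  refine ⟨(G.attr i U).sup r, Finset.Subset.antisymm (fun v hv => ?_)
    fun v hv => (mem_attr hU).2 ⟨_, hv⟩⟩
  exact attrStage_mono G i U (Finset.le_sup hv) (hr v hv)

theorem mem_attr_of_owner {G : PseudoParityGame α} {i : Player} {U : Finset α}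
    (hU : U ⊆ G.verts) {u v : α} (ho : G.owner u = i) (he : (u, v) ∈ G.edges)
    (hv : v ∈ G.attr i U) : u ∈ G.attr i U := by
  classical
  obtain ⟨n, hn⟩ := exists_attr_eq_attrStage (i := i) hU
  exact (mem_attr hU).2 ⟨n + 1, mem_attrStage_succ.2
    (Or.inr (Or.inl ⟨(G.edges_subset _ he).1, ho, v, hn ▸ hv, he⟩))⟩

theorem mem_attr_of_opp {G : PseudoParityGame α} {i : Player} {U : Finset α}
    (hU : U ⊆ G.verts) {u : α} (hu : u ∈ G.verts) (ho : G.owner u = i.opp)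
    (h : ∀ v, (u, v) ∈ G.edges → v ∈ G.attr i U) : u ∈ G.attr i U := by
  classical
  obtain ⟨n, hn⟩ := exists_attr_eq_attrStage (i := i) hU
  exact (mem_attr hU).2 ⟨n + 1, mem_attrStage_succ.2
    (Or.inr (Or.inr ⟨hu, ho, fun v he => hn ▸ h v he⟩))⟩

/-- A set that contains `U` and is closed under attraction contains the attractor. -/
theorem attr_subset_of_closed {G : PseudoParityGame α} {i : Player} {U : Finset α}
    (hU : U ⊆ G.verts) (P : α → Prop) (h0 : ∀ v ∈ U, P v)
    (h1 : ∀ u v, G.owner u = i → (u, v) ∈ G.edges → P v → P u)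
    (h2 : ∀ u ∈ G.verts, G.owner u = i.opp → (∀ v, (u, v) ∈ G.edges → P v) → P u) :
    ∀ v ∈ G.attr i U, P v := by
  classical
  have key : ∀ n, ∀ v ∈ G.attrStage i U n, P v := by
    intro n
    induction n with
    | zero => exact h0
    | succ n ih =>
      intro u hu
      rcases mem_attrStage_succ.1 hu with h | ⟨-, ho, v, hv, he⟩ | ⟨hu, ho, h⟩
      · exact ih u h
      · exact h1 u v ho he (ih v hv)
      · exact h2 u hu ho fun v he => ih v (h v he)
  intro v hv
  obtain ⟨n, hn⟩ := (mem_attr hU).1 hv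
  exact key n v hn

/-- Each stage is added to the region in turn: `i` moves from a new vertex into the previous stage,
and the opponent cannot avoid doing so. -/
theorem IsWinningRegion.attr {G : PseudoParityGame α} {i : Player} {W : Finset α} {f : α → α}
    (h : G.IsWinningRegion i W f) : ∃ g, G.IsWinningRegion i (G.attr i W) g := by
  classical
  obtain ⟨n, hn⟩ := exists_attr_eq_attrStage (i := i) h.subset
  rw [hn]
  clear hn
  induction n with
  | zero => exact ⟨f, h⟩
  | succ n ih =>
    obtain ⟨g, hg⟩ := ih
    have hex : ∀ u, ∃ v, u ∈ G.attrStage i W (n + 1) → u ∉ G.attrStage i W n →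
        G.owner u = i → (u, v) ∈ G.edges ∧ v ∈ G.attrStage i W n := by
      intro u
      by_cases hu : u ∈ G.attrStage i W (n + 1) ∧ u ∉ G.attrStage i W n ∧ G.owner u = i
      · obtain ⟨hu, hu', ho⟩ := hu
        rcases mem_attrStage_succ.1 hu with h | ⟨-, -, v, hv, he⟩ | ⟨-, ho', -⟩
        · exact absurd h hu'
        · exact ⟨v, fun _ _ _ => ⟨he, hv⟩⟩
        · exact absurd (ho'.symm.trans ho) i.opp_ne
      · exact ⟨u, fun a b c => absurd ⟨a, b, c⟩ hu⟩
    choose s hs using hex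
    have hopp : ∀ u ∈ G.attrStage i W (n + 1), u ∉ G.attrStage i W n →
        G.owner u = i.opp → ∀ v, (u, v) ∈ G.edges → v ∈ G.attrStage i W n := by
      intro u hu hu' ho
      rcases mem_attrStage_succ.1 hu with h | ⟨-, ho', -⟩ | ⟨-, -, h⟩
      · exact absurd h hu'
      · exact absurd (ho.symm.trans ho') i.opp_ne
      · exact h
    have hmono := G.attrStage_mono i W n.le_succ
    refine ⟨_, hg.extend (g := s) hmono (attrStage_subset h.subset _) (fun v hv hv' ho => ?_)
      (fun v hv hv' ho w hw => hmono (hopp v hv hv' ho w hw)) fun ρ hρ hmem hout hfol => ?_⟩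
    · exact ⟨(hs v hv hv' ho).1, hmono (hs v hv hv' ho).2⟩
    -- No play avoids the previous stage for even one step, so `hwins` holds vacuously.
    · refine absurd ?_ (hout 1)
      rcases (G.owner (ρ 0)).eq_or_eq_opp i with ho | ho
      · have := (hs _ (hmem 0) (hout 0) ho).2
        rwa [← hfol 0 ho] at this
      · exact hopp _ (hmem 0) (hout 0) ho _ (hρ 0)

/-- Outside an attractor, the attracting player has no edge into it and the opponent has at least
one edge avoiding it. -/
theorem IsParityGame.remove_attr [DecidableEq α] {G : PseudoParityGame α} (hG : G.IsParityGame)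
    {i : Player} {U : Finset α} (hU : U ⊆ G.verts) : (G.remove (G.attr i U)).IsParityGame := by
  intro v hv
  obtain ⟨hv, hvA⟩ := Finset.mem_sdiff.1 hv
  rcases (G.owner v).eq_or_eq_opp i with ho | ho
  · obtain ⟨w, hw⟩ := hG v hv
    exact ⟨w, Finset.mem_filter.2 ⟨hw, hvA, fun h => hvA (mem_attr_of_owner hU ho hw h)⟩⟩
  · by_contra hcon
    refine hvA (mem_attr_of_opp hU hv ho fun w hw => ?_)
    by_contra hwA
    exact hcon ⟨w, Finset.mem_filter.2 ⟨hw, hvA, hwA⟩⟩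

theorem IsWeak.remove [DecidableEq α] {G : PseudoParityGame α} (hG : G.IsWeak) (X : Finset α) :
    (G.remove X).IsWeak :=
  fun v w h => hG v w (Finset.mem_filter.1 h).1

/-! ### The top layer of a weak game -/

theorem topSet_subset (G : PseudoParityGame α) : G.topSet ⊆ G.verts := Finset.filter_subset _ _

/-- The source of an edge has at least the priority of its target, and the target's is already
maximal. -/
theorem IsWeak.mem_topSet_of_edge {G : PseudoParityGame α} (hG : G.IsWeak) {v w : α}
    (he : (v, w) ∈ G.edges) (hw : w ∈ G.topSet) : v ∈ G.topSet := by
  have hv := (G.edges_subset _ he).1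
  refine Finset.mem_filter.2 ⟨hv, le_antisymm (Finset.le_sup hv) ?_⟩
  exact (Finset.mem_filter.1 hw).2.symm.le.trans (hG v w he)

theorem topAttr_eq_topSet {G : PseudoParityGame α} (hG : G.IsParityGame) (hw : G.IsWeak) :
    G.topAttr = G.topSet := by
  refine Finset.Subset.antisymm (fun v hv => ?_) (G.subset_attr _ G.topSet_subset)
  refine attr_subset_of_closed G.topSet_subset (· ∈ G.topSet) (fun _ h => h)
    (fun u v _ he h => hw.mem_topSet_of_edge he h) (fun u hu _ h => ?_) v hv
  obtain ⟨w, he⟩ := hG u hu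
  exact hw.mem_topSet_of_edge he (h w he)

theorem touched_topAttr_eq [DecidableEq α] {G : PseudoParityGame α} (hG : G.IsParityGame)
    (hw : G.IsWeak) : G.touched G.topAttr = G.topSet := by
  rw [topAttr_eq_topSet hG hw, touched, Finset.union_eq_left]
  intro u hu
  obtain ⟨-, v, hv, he⟩ := Finset.mem_filter.1 hu
  exact hw.mem_topSet_of_edge he hv

theorem IsParityGame.firstArg [DecidableEq α] {G : PseudoParityGame α} (hG : G.IsParityGame) :
    G.firstArg.IsParityGame :=
  hG.remove_attr G.topSet_subset

theorem IsWeak.firstArg [DecidableEq α] {G : PseudoParityGame α} (hG : G.IsWeak) :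
    G.firstArg.IsWeak :=
  hG.remove _

theorem oppWin_subset_firstArg [DecidableEq α] (G : PseudoParityGame α) :
    G.oppWin ⊆ G.firstArg.verts :=
  G.firstArg.zielonka.win_subset _

theorem oppWin_subset [DecidableEq α] (G : PseudoParityGame α) : G.oppWin ⊆ G.verts :=
  G.oppWin_subset_firstArg.trans Finset.sdiff_subset

theorem IsParityGame.secondArg [DecidableEq α] {G : PseudoParityGame α} (hG : G.IsParityGame) :
    G.secondArg.IsParityGame :=
  hG.remove_attr G.oppWin_subset

theorem IsWeak.secondArg [DecidableEq α] {G : PseudoParityGame α} (hG : G.IsWeak) :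
    G.secondArg.IsWeak :=
  hG.remove _

theorem card_firstArg_lt [DecidableEq α] {G : PseudoParityGame α} (h : G.verts ≠ ∅) :
    G.firstArg.verts.card < G.verts.card :=
  G.card_remove_lt (G.topSet_nonempty h) G.topSet_subset (G.subset_attr _ G.topSet_subset)

theorem card_secondArg_lt [DecidableEq α] {G : PseudoParityGame α} (h : G.oppWin ≠ ∅) :
    G.secondArg.verts.card < G.verts.card :=
  G.card_remove_lt (Finset.nonempty_iff_ne_empty.2 h) G.oppWin_subset
    (G.subset_attr _ G.oppWin_subset)

/-- Winning regions of `G \ A` are winning regions of a weak game `G`. -/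
theorem IsWinningRegion.of_firstArg [DecidableEq α] {G : PseudoParityGame α}
    (hG : G.IsParityGame) (hw : G.IsWeak) {i : Player} {W : Finset α} {f : α → α}
    (h : G.firstArg.IsWinningRegion i W f) : G.IsWinningRegion i W f := by
  refine h.of_remove fun v hv _ w he hA => (Finset.mem_sdiff.1 (h.subset hv)).2 ?_
  rw [topAttr_eq_topSet hG hw] at hA ⊢
  exact hw.mem_topSet_of_edge he hA

/-- A winning region of the player of the highest priority may be extended by vertices of highest
priority. -/
theorem IsWinningRegion.extend_top [DecidableEq α] {G : PseudoParityGame α}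
    {R S : Finset α} {f : α → α} (hR : G.IsWinningRegion G.topPlayer R f) (hRS : R ⊆ S)
    (hS : S ⊆ G.verts) (htop : ∀ v ∈ S, v ∉ R → v ∈ G.topSet)
    (hmove : ∀ v ∈ S, G.owner v = G.topPlayer → ∃ w ∈ S, (v, w) ∈ G.edges)
    (hclosed : ∀ v ∈ S, G.owner v = G.topPlayer.opp → ∀ w, (v, w) ∈ G.edges → w ∈ S) :
    ∃ g, G.IsWinningRegion G.topPlayer S g := by
  have hex : ∀ v, ∃ w, v ∈ S → G.owner v = G.topPlayer → (v, w) ∈ G.edges ∧ w ∈ S := by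
    intro v
    by_cases hv : v ∈ S ∧ G.owner v = G.topPlayer
    · obtain ⟨w, hw, he⟩ := hmove v hv.1 hv.2
      exact ⟨w, fun _ _ => ⟨he, hw⟩⟩
    · exact ⟨v, fun a b => absurd ⟨a, b⟩ hv⟩
  choose s hs using hex
  refine ⟨_, hR.extend (g := s) hRS hS (fun v hv _ => hs v hv) (fun v hv _ => hclosed v hv)
    fun ρ _ hmem hout _ => ?_⟩
  exact winsPlay_of_const fun n => (Finset.mem_filter.1 (htop _ (hmem n) (hout n))).2

/-! ### Unfolding the algorithm -/

theorem zielonka_of_empty [DecidableEq α] {G : PseudoParityGame α} (h : G.verts = ∅) :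
    (∀ i, G.zielonka.win i = ∅) ∧ G.zielonka.steps = 1 := by
  rw [zielonka, dif_pos h]
  exact ⟨fun _ => rfl, rfl⟩

theorem zielonka_of_oppWin_eq_empty [DecidableEq α] {G : PseudoParityGame α} (h : G.verts ≠ ∅)
    (hW : G.oppWin = ∅) :
    G.zielonka.win G.topPlayer = G.topAttr ∪ G.firstArg.zielonka.win G.topPlayer ∧
    G.zielonka.win G.topPlayer.opp = ∅ ∧
    G.zielonka.steps = 1 + G.topSet.card + G.work (G.touched G.topAttr)
      + G.firstArg.zielonka.steps := by
  have hW' : (zielonka (G.remove G.topAttr)).win G.topPlayer.opp = ∅ := hW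
  rw [zielonka, dif_neg h]
  simp only [hW', dite_true]
  exact ⟨if_pos trivial, if_neg (Player.opp_ne _), rfl⟩

theorem zielonka_of_reachesSecondCall [DecidableEq α] {G : PseudoParityGame α}
    (h : G.ReachesSecondCall) :
    G.zielonka.win G.topPlayer = G.secondArg.zielonka.win G.topPlayer ∧
    G.zielonka.win G.topPlayer.opp = G.secondArg.zielonka.win G.topPlayer.opp ∪
      G.attr G.topPlayer.opp G.oppWin ∧
    G.zielonka.steps = 1 + G.topSet.card + G.work (G.touched G.topAttr)
      + G.firstArg.zielonka.steps + G.work (G.verts \ G.oppWin) + G.secondArg.zielonka.steps := by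
  have hW' : ¬ (zielonka (G.remove G.topAttr)).win G.topPlayer.opp = ∅ := h.2
  rw [zielonka, dif_neg h.1]
  simp only [dif_neg hW']
  exact ⟨if_pos trivial, if_neg (Player.opp_ne _), rfl⟩

/-! ### Correctness -/

/-- The algorithm returns winning regions that cover the game. -/
def IsSolved [DecidableEq α] (G : PseudoParityGame α) : Prop :=
  (∀ i, ∃ f, G.IsWinningRegion i (G.zielonka.win i) f) ∧
    ∀ v ∈ G.verts, ∀ i, v ∉ G.zielonka.win i → v ∈ G.zielonka.win i.opp

theorem IsSolved.intro [DecidableEq α] {G : PseudoParityGame α} (p : Player)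
    (h1 : ∃ f, G.IsWinningRegion p (G.zielonka.win p) f)
    (h2 : ∃ f, G.IsWinningRegion p.opp (G.zielonka.win p.opp) f)
    (h3 : ∀ v ∈ G.verts, v ∉ G.zielonka.win p → v ∈ G.zielonka.win p.opp) : G.IsSolved := by
  refine ⟨fun i => ?_, fun v hv i hi => ?_⟩
  · rcases i.eq_or_eq_opp p with rfl | rfl
    exacts [h1, h2]
  · rcases i.eq_or_eq_opp p with rfl | rfl
    · exact h3 v hv hi
    · by_contra hcon
      rw [Player.opp_opp] at hcon
      exact hi (h3 v hv hcon)

/-- The second call is made on a region won by the player of the highest priority. -/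
theorem exists_isWinningRegion_secondArg [DecidableEq α] {G : PseudoParityGame α}
    (hG : G.IsParityGame) (hw : G.IsWeak) (hs : G.firstArg.IsSolved) :
    ∃ f, G.IsWinningRegion G.topPlayer G.secondArg.verts f := by
  set p := G.topPlayer with hp
  obtain ⟨f, hf⟩ := hs.1 p
  obtain ⟨f', hf'⟩ := hs.1 p.opp
  have hfG := hf.of_firstArg hG hw
  have hcl : ∀ v ∈ G.firstArg.verts, v ∉ G.oppWin → v ∈ G.firstArg.zielonka.win p := by
    intro v hv hn
    have := hs.2 v hv p.opp hn
    rwa [Player.opp_opp] at this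
  -- The complement of a winning region of `p` is closed under attraction by the opponent, so `B`
  -- misses the part won by `p` below.
  have hdisj : ∀ v ∈ G.attr p.opp G.oppWin, v ∉ G.firstArg.zielonka.win p := by
    refine attr_subset_of_closed G.oppWin_subset _ (fun v hv hv' => ?_)
      (fun u v ho he hv hu => ?_) (fun u hu ho h hu' => ?_)
    · exact hf.notMem_of_opp hG.firstArg hf' hv' hv
    · exact hv (hfG.closed u hu ho v he)
    · rw [Player.opp_opp] at ho
      have := hfG.move u hu' ho
      exact h _ this.1 this.2
  refine hfG.extend_top (fun v hv => ?_) Finset.sdiff_subset (fun v hv hv' => ?_)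
    (fun v hv _ => ?_) (fun v hv ho w he => ?_)
  · exact Finset.mem_sdiff.2 ⟨hfG.subset hv, fun h => hdisj v h hv⟩
  · obtain ⟨hv, hB⟩ := Finset.mem_sdiff.1 hv
    rw [← topAttr_eq_topSet hG hw]
    by_contra hA
    exact hv' (hcl v (Finset.mem_sdiff.2 ⟨hv, hA⟩)
      fun h => hB (G.subset_attr _ G.oppWin_subset h))
  · obtain ⟨w, he⟩ := hG.secondArg v hv
    exact ⟨w, (G.secondArg.edges_subset _ he).2, (Finset.mem_filter.1 he).1⟩
  · refine Finset.mem_sdiff.2 ⟨(G.edges_subset _ he).2, fun h => ?_⟩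
    exact (Finset.mem_sdiff.1 hv).2 (mem_attr_of_owner G.oppWin_subset ho he h)

theorem exists_isWinningRegion_attr_oppWin [DecidableEq α] {G : PseudoParityGame α}
    (hG : G.IsParityGame) (hw : G.IsWeak) (hs : G.firstArg.IsSolved) :
    ∃ f, G.IsWinningRegion G.topPlayer.opp (G.attr G.topPlayer.opp G.oppWin) f := by
  obtain ⟨f, hf⟩ := hs.1 G.topPlayer.opp
  exact (hf.of_firstArg hG hw).attr

theorem IsSolved.win_eq_of_isWinningRegion [DecidableEq α] {G : PseudoParityGame α}
    (hG : G.IsParityGame) (hs : G.IsSolved) {i : Player} {f : α → α}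
    (h : G.IsWinningRegion i G.verts f) :
    G.zielonka.win i = G.verts ∧ G.zielonka.win i.opp = ∅ := by
  obtain ⟨f', hf'⟩ := hs.1 i.opp
  have hno : ∀ v ∈ G.verts, v ∉ G.zielonka.win i.opp := fun v hv => h.notMem_of_opp hG hf' hv
  refine ⟨Finset.Subset.antisymm (G.zielonka.win_subset i) fun v hv => ?_,
    Finset.eq_empty_of_forall_notMem fun v hv => hno v (hf'.subset hv) hv⟩
  have := hs.2 v hv i.opp (hno v hv)
  rwa [Player.opp_opp] at this

theorem isSolved [DecidableEq α] (G : PseudoParityGame α) (hG : G.IsParityGame)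
    (hw : G.IsWeak) : G.IsSolved := by
  by_cases hV : G.verts = ∅
  · have hz := (zielonka_of_empty hV).1
    refine ⟨fun i => ⟨id, ?_⟩, fun v hv => by simp [hV] at hv⟩
    rw [hz]
    exact isWinningRegion_empty G i
  have hlt := card_firstArg_lt hV
  have hs := isSolved G.firstArg hG.firstArg hw.firstArg
  by_cases hW : G.oppWin = ∅
  · obtain ⟨e1, e2, -⟩ := zielonka_of_oppWin_eq_empty hV hW
    have hall : G.zielonka.win G.topPlayer = G.verts := by
      refine Finset.Subset.antisymm (G.zielonka.win_subset _) fun v hv => ?_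
      rw [e1, Finset.mem_union]
      by_contra! hcon
      have hmem := hs.2 v (Finset.mem_sdiff.2 ⟨hv, hcon.1⟩) _ hcon.2
      change v ∈ G.oppWin at hmem
      simp [hW] at hmem
    refine IsSolved.intro G.topPlayer ?_ ?_ ?_
    · rw [hall]
      obtain ⟨f, hf⟩ := hs.1 G.topPlayer
      have hfG := hf.of_firstArg hG hw
      refine hfG.extend_top hfG.subset subset_rfl (fun v hv hv' => ?_) (fun v hv _ => ?_)
        (fun v _ _ w he => (G.edges_subset _ he).2)
      · rw [← hall, e1, Finset.mem_union, topAttr_eq_topSet hG hw] at hv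
        exact hv.resolve_right hv'
      · obtain ⟨w, he⟩ := hG v hv
        exact ⟨w, (G.edges_subset _ he).2, he⟩
    · rw [e2]
      exact ⟨id, isWinningRegion_empty G _⟩
    · intro v hv hn
      rw [hall] at hn
      exact absurd hv hn
  · have hlt' := card_secondArg_lt hW
    have hs' := isSolved G.secondArg hG.secondArg hw.secondArg
    obtain ⟨e1, e2, -⟩ := zielonka_of_reachesSecondCall ⟨hV, hW⟩
    obtain ⟨f, hf⟩ := exists_isWinningRegion_secondArg hG hw hs
    have hf2 : G.secondArg.IsWinningRegion G.topPlayer G.secondArg.verts f :=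
      hf.remove fun v hv => (Finset.mem_sdiff.1 hv).2
    -- On a paradise for `p` the second call assigns nothing to the opponent, so the answer is
    -- exactly `V \ B` and `B`.
    obtain ⟨a1, a2⟩ := hs'.win_eq_of_isWinningRegion hG.secondArg hf2
    rw [a1] at e1
    rw [a2, Finset.empty_union] at e2
    refine IsSolved.intro G.topPlayer ?_ ?_ ?_
    · rw [e1]
      exact ⟨f, hf⟩
    · rw [e2]
      exact exists_isWinningRegion_attr_oppWin hG hw hs
    · intro v hv hn
      rw [e1] at hn
      rw [e2]
      by_contra hB
      exact hn (Finset.mem_sdiff.2 ⟨hv, hB⟩)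
termination_by G.verts.card

theorem mem_win_iff [DecidableEq α] {G : PseudoParityGame α} (hG : G.IsParityGame)
    (hw : G.IsWeak) (i : Player) (v : α) :
    v ∈ G.zielonka.win i ↔ v ∈ G.verts ∧ G.WonBy i v := by
  have hs := G.isSolved hG hw
  obtain ⟨f, hf⟩ := hs.1 i
  obtain ⟨f', hf'⟩ := hs.1 i.opp
  refine ⟨fun h => ⟨hf.subset h, hf.wonBy h⟩, fun ⟨hv, hwon⟩ => ?_⟩
  by_contra hn
  exact hf'.not_wonBy hG (hs.2 v hv i hn) hwon

/-! ### Running time -/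

theorem card_verts_firstArg [DecidableEq α] {G : PseudoParityGame α} (hG : G.IsParityGame)
    (hw : G.IsWeak) : G.firstArg.verts.card + G.topSet.card = G.verts.card := by
  change (G.verts \ G.topAttr).card + _ = _
  rw [topAttr_eq_topSet hG hw]
  exact Finset.card_sdiff_add_card_eq_card G.topSet_subset

/-- Edges split into those that meet `U` and those that avoid it. With `card_verts_firstArg` this
makes the drop in vertices plus edges exactly `G.work G.topSet`, which drives the telescoping. -/
theorem card_edges_firstArg [DecidableEq α] {G : PseudoParityGame α} (hG : G.IsParityGame)
    (hw : G.IsWeak) :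
    G.firstArg.edges.card + G.work G.topSet = G.edges.card + G.topSet.card := by
  have h := Finset.card_filter_add_card_filter_not (s := G.edges)
    (fun e : α × α => e.1 ∈ G.topSet ∨ e.2 ∈ G.topSet)
  simp only [not_or] at h
  change (G.edges.filter fun e => e.1 ∉ G.topAttr ∧ e.2 ∉ G.topAttr).card + _ = _
  rw [topAttr_eq_topSet hG hw, work]
  omega

theorem work_le [DecidableEq α] {G : PseudoParityGame α} {N : Finset α} (hN : N ⊆ G.verts) :
    G.work N ≤ G.verts.card + G.edges.card :=
  add_le_add (Finset.card_le_card hN) (Finset.card_filter_le _ _)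

/-- The highest priority disappears, because `A` contains every vertex carrying it. -/
theorem numPrios_firstArg_lt [DecidableEq α] {G : PseudoParityGame α} (h : G.verts ≠ ∅) :
    G.firstArg.numPrios < G.numPrios := by
  obtain ⟨v, hv⟩ := G.topSet_nonempty h
  obtain ⟨hvV, hvm⟩ := Finset.mem_filter.1 hv
  refine Finset.card_lt_card ⟨Finset.image_subset_image Finset.sdiff_subset, fun hsub => ?_⟩
  obtain ⟨w, hw, hwm⟩ := Finset.mem_image.1 (hsub (Finset.mem_image_of_mem G.prio hvV))
  obtain ⟨hwV, hwA⟩ := Finset.mem_sdiff.1 hw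
  exact hwA (G.subset_attr _ G.topSet_subset (Finset.mem_filter.2 ⟨hwV, hwm.trans hvm⟩))

/-- The algorithm takes linear time on weak games that are won everywhere by one player. -/
theorem steps_le_of_win_opp_eq_empty [DecidableEq α] (G : PseudoParityGame α)
    (hG : G.IsParityGame) (hw : G.IsWeak) (q : Player) (hq : G.zielonka.win q.opp = ∅) :
    G.zielonka.steps ≤ 5 * (G.verts.card + G.edges.card) + 1 := by
  by_cases hV : G.verts = ∅
  · rw [(zielonka_of_empty hV).2]
    omega
  have hlt := card_firstArg_lt hV
  have hs := G.isSolved hG hw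
  have hs1 := G.firstArg.isSolved hG.firstArg hw.firstArg
  obtain ⟨f, hf⟩ := hs.1 q
  have hall : ∀ v ∈ G.verts, v ∈ G.zielonka.win q := fun v hv => by
    by_contra hn
    simpa [hq] using hs.2 v hv q hn
  have hq1 : G.firstArg.zielonka.win q.opp = ∅ := by
    obtain ⟨f', hf'⟩ := hs1.1 q.opp
    refine Finset.eq_empty_of_forall_notMem fun v hv => ?_
    have hfG := hf'.of_firstArg hG hw
    exact hf.notMem_of_opp hG hfG (hall v (hfG.subset hv)) hv
  have ih := steps_le_of_win_opp_eq_empty G.firstArg hG.firstArg hw.firstArg q hq1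
  have c1 := card_verts_firstArg hG hw
  have c2 := card_edges_firstArg hG hw
  have c3 : 0 < G.topSet.card := (G.topSet_nonempty hV).card_pos
  have c4 : G.topSet.card ≤ G.work G.topSet := Nat.le_add_right _ _
  by_cases hW : G.oppWin = ∅
  · rw [(zielonka_of_oppWin_eq_empty hV hW).2.2, touched_topAttr_eq hG hw]
    omega
  · rw [(zielonka_of_reachesSecondCall ⟨hV, hW⟩).2.2, touched_topAttr_eq hG hw]
    have hpq : q = G.topPlayer.opp := by
      rcases q.eq_or_eq_opp G.topPlayer with rfl | h
      · exact absurd hq1 hW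
      · exact h
    subst hpq
    have hfull : G.verts \ G.oppWin = G.topSet := by
      rw [← topAttr_eq_topSet hG hw]
      ext v
      rw [Finset.mem_sdiff]
      constructor
      · rintro ⟨hv, hn⟩
        by_contra hA
        have hmem := hs1.2 v (Finset.mem_sdiff.2 ⟨hv, hA⟩) _ hn
        simp [hq1] at hmem
      · intro hv
        exact ⟨G.attr_subset _ _ hv, fun h =>
          (Finset.mem_sdiff.1 (G.oppWin_subset_firstArg h)).2 hv⟩
    have hemp : G.secondArg.verts = ∅ := by
      obtain ⟨f', hf'⟩ := exists_isWinningRegion_secondArg hG hw hs1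
      exact Finset.eq_empty_of_forall_notMem fun v hv =>
        hf'.notMem_of_opp hG hf hv (hall v (hf'.subset hv))
    rw [hfull, (zielonka_of_empty hemp).2]
    -- The level costs `2 + |U| + 2 * work U`, counting the one step of the empty second call. As `1
    -- ≤ |U| ≤ work U`, this is at most `5 * work U`, whence the constant.
    omega
termination_by G.verts.card

theorem secondArg_isParadise_and_steps_le [DecidableEq α] {G : PseudoParityGame α}
    (hG : G.IsParityGame) (hw : G.IsWeak) :
    G.secondArg.IsParadise G.topPlayer ∧
      G.secondArg.zielonka.steps ≤ 5 * (G.secondArg.verts.card + G.secondArg.edges.card) + 1 := by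
  obtain ⟨f, hf⟩ := exists_isWinningRegion_secondArg hG hw
    (G.firstArg.isSolved hG.firstArg hw.firstArg)
  have hf2 : G.secondArg.IsWinningRegion G.topPlayer G.secondArg.verts f :=
    hf.remove fun v hv => (Finset.mem_sdiff.1 hv).2
  refine ⟨fun v hv => hf2.wonBy hv, ?_⟩
  exact steps_le_of_win_opp_eq_empty _ hG.secondArg hw.secondArg G.topPlayer
    ((G.secondArg.isSolved hG.secondArg hw.secondArg).win_eq_of_isWinningRegion
      hG.secondArg hf2).2

theorem steps_le [DecidableEq α] (G : PseudoParityGame α) (hG : G.IsParityGame)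
    (hw : G.IsWeak) :
    G.zielonka.steps ≤ 10 * (G.numPrios * (G.verts.card + G.edges.card) + 1) := by
  by_cases hV : G.verts = ∅
  · rw [(zielonka_of_empty hV).2]
    omega
  have hlt := card_firstArg_lt hV
  have ih := steps_le G.firstArg hG.firstArg hw.firstArg
  have c1 := card_verts_firstArg hG hw
  have c2 := card_edges_firstArg hG hw
  have c3 : 0 < G.topSet.card := (G.topSet_nonempty hV).card_pos
  have c4 : G.topSet.card ≤ G.work G.topSet := Nat.le_add_right _ _
  have c5 := work_le G.topSet_subset
  have c6 : G.work (G.verts \ G.oppWin) ≤ _ := work_le Finset.sdiff_subset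
  have key : G.firstArg.numPrios * (G.firstArg.verts.card + G.firstArg.edges.card) +
      (G.verts.card + G.edges.card) ≤ G.numPrios * (G.verts.card + G.edges.card) := by
    have h1 : G.firstArg.verts.card + G.firstArg.edges.card ≤ G.verts.card + G.edges.card := by
      omega
    calc _ ≤ G.firstArg.numPrios * (G.verts.card + G.edges.card) +
          (G.verts.card + G.edges.card) := by gcongr
      _ = (G.firstArg.numPrios + 1) * (G.verts.card + G.edges.card) := by ring
      _ ≤ _ := Nat.mul_le_mul_right _ (numPrios_firstArg_lt hV)
  by_cases hW : G.oppWin = ∅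
  · rw [(zielonka_of_oppWin_eq_empty hV hW).2.2, touched_topAttr_eq hG hw]
    omega
  · rw [(zielonka_of_reachesSecondCall ⟨hV, hW⟩).2.2, touched_topAttr_eq hG hw]
    have hp := (secondArg_isParadise_and_steps_le hG hw).2
    have b1 : G.secondArg.verts.card ≤ G.verts.card := Finset.card_le_card Finset.sdiff_subset
    have b2 : G.secondArg.edges.card ≤ G.edges.card := Finset.card_filter_le _ _
    -- With `n = |V| + |E|`, the level without its first call costs at most `2 + |U| + 2n + 5n`,
    -- where `5n + 1` bounds the second call. Since `1 ≤ |U| ≤ n`, this is at most `10n`, which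
    -- `key` pays for by the lost priority.
    omega
termination_by G.verts.card

theorem Invokes.isParityGame_and_isWeak [DecidableEq α] {G H : PseudoParityGame α}
    (h : G.Invokes H) (hG : G.IsParityGame) (hw : G.IsWeak) : H.IsParityGame ∧ H.IsWeak := by
  induction h with
  | self => exact ⟨hG, hw⟩
  | first H _ _ ih => exact ⟨ih.1.firstArg, ih.2.firstArg⟩
  | second H _ _ ih => exact ⟨ih.1.secondArg, ih.2.secondArg⟩

end PseudoParityGame

theorem mainTheorem5 :
    ∃ C : ℕ, ∀ (α : Type*) [DecidableEq α] (G : PseudoParityGame α),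
      G.IsParityGame → G.IsWeak →
        -- the algorithm solves `G`
        (∀ (i : Player) (v : α), v ∈ G.zielonka.win i ↔ v ∈ G.verts ∧ G.WonBy i v) ∧
        -- every second recursive call is made on a paradise and takes linear time
        (∀ H : PseudoParityGame α, G.Invokes H → H.ReachesSecondCall →
          H.secondArg.IsParityGame ∧ H.secondArg.IsWeak ∧
          H.secondArg.IsParadise H.topPlayer ∧
          H.secondArg.zielonka.steps ≤
            C * (H.secondArg.verts.card + H.secondArg.edges.card + 1)) ∧
        -- the total running time
        G.zielonka.steps ≤ C * (G.numPrios * (G.verts.card + G.edges.card) + 1) := by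
  refine ⟨10, fun α _ G hG hw => ⟨PseudoParityGame.mem_win_iff hG hw, fun H hH _ => ?_, G.steps_le hG hw⟩⟩
  obtain ⟨hHG, hHw⟩ := hH.isParityGame_and_isWeak hG hw
  obtain ⟨h1, h2⟩ := PseudoParityGame.secondArg_isParadise_and_steps_le hHG hHw
  exact ⟨hHG.secondArg, hHw.secondArg, h1, h2.trans (by omega)⟩
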